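/- All graphs are finite and simple. A graph is outerplanar if it can be drawn in the plane without crossings so that all its vertices lie on the outer face, i.e. drawn in a closed disc with all vertices on the boundary circle. A block of a graph is a maximal connected subgraph that has no cut-vertex, and $|B|$ is the number of vertices of a block $B$. In the localization game with $k$ cops on a connected graph $G$, the robber, unseen by the cops, first chooses a vertex. In each round the cops choose any vertices $c_1,\dots,c_k$ of $G$ and learn the distances $(d(c_1,r),\dots,d(c_k,r))$ to the robber's current position $r$; then the robber stays at $r$ or moves to a neighbor of $r$. The cops win when their observations determine the position of the robber. The localization number $\zeta(G)$ is the least $k$ for which $k$ cops can win after finitely many rounds, however the robber plays. The $k$-localization capture time $\mathrm{lcapt}_k(G)$ is the least number of rounds within which $k$ cops can win, however the robber plays (it is $\infty$ if there is no such number, and $0$ if $G$ has only one vertex), and $\mathrm{lcapt}(G)=\mathrm{lcapt}_{\zeta(G)}(G)$. A family of connected graphs is well-localizable if there is a constant $D$ such that $\mathrm{lcapt}(G)\le D\,|V(G)|$ for every $G$ in the family. **Proposition.** If $G$ is a connected outerplanar graph that is an edge-disjoint union of blocks $B_1,\dots,B_m$, then $$\mathrm{lcapt}_2(G)\le\sum_{i=1}^m\bigl(|B_i|-1\bigr).$$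 Consequently, every connected outerplanar graph $G$ on $n$ vertices with $\zeta(G)=2$ satisfies $\mathrm{lcapt}(G)\le n-1$; in particular, the family of connected outerplanar graphs with localization number $2$ is well-localizable. -/

import Mathlib

universe u

namespace SimpleGraph

/-! ### Outerplanar graphs -/

/-- A crossing-free drawing of `G` in the closed unit disc of the plane `ℂ` with all vertices on the
boundary circle (so that every vertex lies on the outer face). Vertices are distinct points, every
edge is a simple arc joining its two ends, an arc passes through no vertex other than the ends of
its edge, and the arcs of two different edges meet only in common ends. The values of `arc` on
pairs that are not edges are irrelevant. -/
structure OuterDrawing {V : Type*} (G : SimpleGraph V) where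
  pos : V → ℂ
  pos_injective : Function.Injective pos
  pos_mem_circle : ∀ v, pos v ∈ Metric.sphere (0 : ℂ) 1
  arc : Sym2 V → Set ℂ
  arc_isArc : ∀ u v, G.Adj u v →
    ∃ γ : _root_.Path (pos u) (pos v), Function.Injective γ ∧ Set.range γ = arc s(u, v)
  arc_subset_disc : ∀ e ∈ G.edgeSet, arc e ⊆ Metric.closedBall (0 : ℂ) 1
  vertex_on_arc : ∀ e ∈ G.edgeSet, ∀ v, pos v ∈ arc e → v ∈ e
  arcs_meet : ∀ e ∈ G.edgeSet, ∀ f ∈ G.edgeSet, e ≠ f →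
    ∀ z, z ∈ arc e → z ∈ arc f → ∃ v, v ∈ e ∧ v ∈ f ∧ z = pos v

/-- `G` is outerplanar: it can be drawn without crossings in a closed disc, with all of its
vertices on the boundary of the disc. -/
def IsOuterplanar {V : Type*} (G : SimpleGraph V) : Prop :=
  Nonempty G.OuterDrawing

/-! ### Blocks -/

/-- The subgraph `H` is connected and has no cut-vertex, i.e. deleting any one of its vertices does
not disconnect it. -/
def IsNonseparable {V : Type*} {G : SimpleGraph V} (H : G.Subgraph) : Prop :=
  H.Connected ∧ ∀ v ∈ H.verts, (H.deleteVerts {v}).Preconnected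

/-- A block of `G` is a maximal connected subgraph that has no cut-vertex. -/
def IsBlock {V : Type*} {G : SimpleGraph V} (B : G.Subgraph) : Prop :=
  Maximal (fun H : G.Subgraph => IsNonseparable H) B

/-! ### The localization game -/

/-- A strategy of `k` cops: the vertices to be probed next, as a function of the list of all
distance vectors observed so far. -/
abbrev CopStrategy (V : Type*) (k : ℕ) : Type _ :=
  List (Fin k → ℕ) → Fin k → V

/-- A trajectory of the robber: `r 0` is the vertex chosen at the start, and `r (i + 1)` is his
position after his move at the end of round `i + 1`; he stays or moves to a neighbor. Thus the
probe of round `i + 1` meets him at `r i`. -/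
def IsTrajectory {V : Type*} (G : SimpleGraph V) (r : ℕ → V) : Prop :=
  ∀ i, r (i + 1) = r i ∨ G.Adj (r i) (r (i + 1))

/-- The distance vectors that the strategy `σ` observes in the first `t` rounds against the
trajectory `r`, in chronological order. -/
noncomputable def answers {V : Type*} (G : SimpleGraph V) {k : ℕ} (σ : CopStrategy V k)
    (r : ℕ → V) : ℕ → List (Fin k → ℕ)
  | 0 => []
  | t + 1 => answers G σ r t ++ [fun j => G.dist (σ (answers G σ r t) j) (r t)]

/-- The cops know the position of a robber with trajectory `r` right after the probe of round `t`:
all trajectories that give the same observations in the first `t` rounds have the same position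
at that time, which is `r (t - 1)` if `1 ≤ t`. Without any probe (`t = 0`, where `t - 1 = 0`) this
says that the initial position is known beforehand, i.e. that there is only one vertex. -/
def LocatedAfter {V : Type*} (G : SimpleGraph V) {k : ℕ} (σ : CopStrategy V k)
    (r : ℕ → V) (t : ℕ) : Prop :=
  ∀ r' : ℕ → V, G.IsTrajectory r' → answers G σ r' t = answers G σ r t → r' (t - 1) = r (t - 1)

/-- `k` cops can win on `G`: some strategy locates every robber after finitely many rounds. -/
def CopsWin {V : Type*} (G : SimpleGraph V) (k : ℕ) : Prop :=
  ∃ σ : CopStrategy V k, ∀ r : ℕ → V, G.IsTrajectory r → ∃ t, LocatedAfter G σ r t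

/-- `k` cops can win on `G` within `T` rounds, however the robber plays. -/
def CopsWinWithin {V : Type*} (G : SimpleGraph V) (k T : ℕ) : Prop :=
  ∃ σ : CopStrategy V k, ∀ r : ℕ → V, G.IsTrajectory r → ∃ t ≤ T, LocatedAfter G σ r t

/-- The localization number `ζ(G)`: the least number of cops that can win on `G`. -/
noncomputable def localizationNumber {V : Type*} (G : SimpleGraph V) : ℕ :=
  sInf {k | G.CopsWin k}

/-- The `k`-localization capture time of `G`: the least number of rounds in which `k` cops can
win, and `⊤` if there is no such number. -/
noncomputable def kLocalizationCaptureTime {V : Type*} (G : SimpleGraph V) (k : ℕ) : ℕ∞ :=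
  ⨅ T ∈ {T : ℕ | G.CopsWinWithin k T}, (T : ℕ∞)

/-- The localization capture time of `G`, played with `ζ(G)` cops. -/
noncomputable def localizationCaptureTime {V : Type*} (G : SimpleGraph V) : ℕ∞ :=
  G.kLocalizationCaptureTime G.localizationNumber

/-- A family of finite graphs is well-localizable if for some constant `D` every member on `n`
vertices has localization capture time at most `D * n`. -/
def WellLocalizable (F : ∀ V : Type u, SimpleGraph V → Prop) : Prop :=
  ∃ D : ℕ, ∀ (V : Type u) [Finite V] (G : SimpleGraph V), F V G →
    G.localizationCaptureTime ≤ (D : ℕ∞) * (Nat.card V : ℕ∞)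

end SimpleGraph

/-! Cutting the boundary circle at a point orders the vertices linearly so that no two edges
interleave. The cops keep the robber's possible positions inside an order interval `[u, v]` that
contains a geodesic from `u` to `v`. Such a geodesic is a barrier, so distances and moves inside the
interval are well controlled. The core is `exists_probe`: in every such interval with `u < v`, some
pair of probes either locates the robber or confines him, even after his move, to a strictly smaller
interval of this kind. Starting from all `n` vertices, `n - 1` rounds suffice.

If `d(u, v) ≥ 2`, probing `u` and `v` works. If `uv` is an edge, this can fail only when there are a
triangle `u, w, v` and an edge `cx` under `uw` with `c` nearer to `u` and `x` nearer to `w`. Then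
probing `c` and `v` works, since a second failure would give another such edge, incompatible with
the first.

The block bound follows from `n - 1 ≤ ∑ (|B i| - 1)`: spanning trees of the blocks together form a
connected spanning subgraph. -/

namespace SimpleGraph

/-! ### Interleaved paths in a disc meet -/

section Topology

open scoped unitInterval

/-- On the right half-plane the principal logarithm is continuous, so `g - log w` is a continuous
lift of the constant `k` through `exp`, hence constant. -/
theorem lift_sub_eq_log_sub {g w : I → ℂ} (hg : Continuous g) (hw : Continuous w) {k : ℂ}
    (hre : ∀ t, 0 < (w t).re) (h : ∀ t, Complex.exp (g t) = k * w t) :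
    g 1 - g 0 = Complex.log (w 1) - Complex.log (w 0) := by
  have hlog : Continuous fun t => Complex.log (w t) :=
    hw.clog fun t => Or.inl (hre t)
  have hne : ∀ t, w t ≠ 0 := fun t h0 => by have := hre t; simp [h0] at this
  have hexp : ∀ t, Complex.exp (g t - Complex.log (w t)) = k := fun t => by
    rw [Complex.exp_sub, h, Complex.exp_log (hne t), mul_div_assoc, div_self (hne t), mul_one]
  have key := Complex.isCoveringMap_exp.eq_of_comp_eq
    (g₁ := fun t : I => g t - Complex.log (w t))
    (g₂ := fun _ : I => g 0 - Complex.log (w 0)) (hg.sub hlog) continuous_const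
    (by funext t; exact Subtype.ext ((hexp t).trans (hexp 0).symm)) 0 rfl
  have := congrFun key 1
  linear_combination this

theorem re_one_sub_div_pos {a z : ℂ} (ha : ‖a‖ = 1) (hz : ‖z‖ ≤ 1) (hne : z ≠ a) :
    0 < (1 - z / a).re := by
  have ha0 : a ≠ 0 := fun h => by simp [h] at ha
  have hn : ‖z / a‖ ≤ 1 := by rw [norm_div, ha, div_one]; exact hz
  have h1 : (z / a).re ≤ 1 := (Complex.re_le_norm _).trans hn
  rcases h1.lt_or_eq with h | h
  · simpa using h
  · exfalso
    have h2 : ‖z / a‖ ^ 2 = (z / a).re ^ 2 + (z / a).im ^ 2 := by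
      rw [Complex.sq_norm, Complex.normSq_apply]; ring
    have h3 : (z / a).im = 0 := by nlinarith [norm_nonneg (z / a), sq_nonneg (z / a).im]
    have : z / a = 1 := Complex.ext (by simpa using h) (by simpa using h3)
    exact hne (by field_simp at this; exact this)

theorem arg_one_sub_exp {φ : ℝ} (h0 : 0 < φ) (h1 : φ < 2 * Real.pi) :
    (1 - Complex.exp (φ * Complex.I)).arg = (φ - Real.pi) / 2 := by
  have hs : 0 < 2 * Real.sin (φ / 2) :=
    mul_pos two_pos (Real.sin_pos_of_pos_of_lt_pi (by linarith) (by linarith))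
  have key : 1 - Complex.exp (φ * Complex.I) = ((2 * Real.sin (φ / 2) : ℝ) : ℂ) *
      (Complex.cos (((φ - Real.pi) / 2 : ℝ) : ℂ) +
        Complex.sin (((φ - Real.pi) / 2 : ℝ) : ℂ) * Complex.I) := by
    have e1 : Real.cos ((φ - Real.pi) / 2) = Real.sin (φ / 2) := by
      rw [show (φ - Real.pi) / 2 = φ / 2 - Real.pi / 2 by ring, Real.cos_sub_pi_div_two]
    have e2 : Real.sin ((φ - Real.pi) / 2) = -Real.cos (φ / 2) := by
      rw [show (φ - Real.pi) / 2 = φ / 2 - Real.pi / 2 by ring, Real.sin_sub_pi_div_two]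
    have e3 : Real.cos φ = 1 - 2 * Real.sin (φ / 2) ^ 2 := by
      rw [show φ = 2 * (φ / 2) by ring, Real.cos_two_mul, Real.cos_sq']; ring_nf
    have e4 : Real.sin φ = 2 * Real.sin (φ / 2) * Real.cos (φ / 2) := by
      rw [show φ = 2 * (φ / 2) by ring, Real.sin_two_mul]; ring_nf
    rw [← Complex.ofReal_cos, ← Complex.ofReal_sin, e1, e2, Complex.exp_mul_I,
      ← Complex.ofReal_cos, ← Complex.ofReal_sin, e3, e4]
    push_cast
    ring
  rw [key, Complex.arg_mul_cos_add_sin_mul_I hs]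
  constructor <;> linarith

theorem arg_one_sub_inv {z : ℂ} (hz : ‖z‖ = 1) (hne : z ≠ 1) :
    (1 - z⁻¹).arg = -(1 - z).arg := by
  have hre : 0 < (1 - z).re := by
    simpa using re_one_sub_div_pos (a := 1) (by simp) hz.le hne
  have h1 : z⁻¹ = starRingEnd ℂ z := Complex.inv_eq_conj hz
  have h2 : 1 - starRingEnd ℂ z = starRingEnd ℂ (1 - z) := by simp
  rw [h1, h2, Complex.arg_conj, if_neg]
  intro h
  rw [Complex.arg_eq_pi_iff] at h
  linarith [h.1]

/-- Two paths in the closed unit disc whose ends interleave on the boundary circle meet. -/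
theorem exists_eq_of_interleaved {α β γ δ : ℝ} (hαβ : α < β) (hβγ : β < γ) (hγδ : γ < δ)
    (hδα : δ < α + 2 * Real.pi)
    (p : _root_.Path (Complex.exp (α * Complex.I)) (Complex.exp (γ * Complex.I)))
    (q : _root_.Path (Complex.exp (β * Complex.I)) (Complex.exp (δ * Complex.I)))
    (hp : ∀ s, ‖p s‖ ≤ 1) (hq : ∀ t, ‖q t‖ ≤ 1) : ∃ s t, p s = q t := by
  by_contra! hne
  have hπ := Real.pi_pos
  have hproj : Continuous (Set.projIcc (0 : ℝ) 1 zero_le_one) := continuous_projIcc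
  -- If the paths never meet, `p s - q t` has a continuous logarithm `F` on the whole square. Along
  -- each side one path rests at a point of the circle, so the change of `F` is a difference of
  -- principal logarithms.
  let f : C(ℝ × ℝ, {z : ℂ // z ≠ 0}) :=
    ⟨fun x => ⟨p (Set.projIcc 0 1 zero_le_one x.1) - q (Set.projIcc 0 1 zero_le_one x.2),
      sub_ne_zero.2 (hne _ _)⟩, by fun_prop⟩
  let e0 : ℂ := Complex.log (f (0, 0)).1
  have he0 : (⟨_, e0.exp_ne_zero⟩ : {z : ℂ // z ≠ 0}) = f (0, 0) :=
    Subtype.ext (Complex.exp_log (f (0, 0)).2)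
  obtain ⟨F, ⟨-, hF⟩, -⟩ :=
    Complex.isCoveringMap_exp.existsUnique_continuousMap_lifts f (0, 0) e0 he0
  have hexp : ∀ s t : I, Complex.exp (F ((s : ℝ), (t : ℝ))) = p s - q t := fun s t => by
    have := congrArg Subtype.val (congrFun hF ((s : ℝ), (t : ℝ)))
    simpa [f] using this
  have hn : ∀ θ : ℝ, ‖Complex.exp (θ * Complex.I)‖ = 1 := Complex.norm_exp_ofReal_mul_I
  have h0 : ∀ θ : ℝ, Complex.exp (θ * Complex.I) ≠ 0 := fun _ => Complex.exp_ne_zero _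
  have s0 := lift_sub_eq_log_sub (g := fun t : I => F ((0 : I), (t : ℝ)))
    (w := fun t => 1 - q t / Complex.exp (α * Complex.I)) (k := Complex.exp (α * Complex.I))
    (by fun_prop) (by fun_prop)
    (fun t => re_one_sub_div_pos (hn _) (hq t) fun h => hne 0 t (by simp [h]))
    (fun t => by rw [hexp, p.source]; field_simp [h0])
  have s1 := lift_sub_eq_log_sub (g := fun t : I => F ((1 : I), (t : ℝ)))
    (w := fun t => 1 - q t / Complex.exp (γ * Complex.I)) (k := Complex.exp (γ * Complex.I))
    (by fun_prop) (by fun_prop)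
    (fun t => re_one_sub_div_pos (hn _) (hq t) fun h => hne 1 t (by simp [h]))
    (fun t => by rw [hexp, p.target]; field_simp [h0])
  have t0 := lift_sub_eq_log_sub (g := fun s : I => F ((s : ℝ), (0 : I)))
    (w := fun s => 1 - p s / Complex.exp (β * Complex.I)) (k := -Complex.exp (β * Complex.I))
    (by fun_prop) (by fun_prop)
    (fun s => re_one_sub_div_pos (hn _) (hp s) fun h => hne s 0 (by simp [h]))
    (fun s => by rw [hexp, q.source]; field_simp [h0]; ring)
  have t1 := lift_sub_eq_log_sub (g := fun s : I => F ((s : ℝ), (1 : I)))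
    (w := fun s => 1 - p s / Complex.exp (δ * Complex.I)) (k := -Complex.exp (δ * Complex.I))
    (by fun_prop) (by fun_prop)
    (fun s => re_one_sub_div_pos (hn _) (hp s) fun h => hne s 1 (by simp [h]))
    (fun s => by rw [hexp, q.target]; field_simp [h0]; ring)
  simp only [p.source, p.target, q.source, q.target, ← Complex.exp_sub, ← sub_mul,
    ← Complex.ofReal_sub] at s0 s1 t0 t1
  have hA : ∀ x y : ℝ, 0 < y - x → y - x < 2 * Real.pi →
      (Complex.log (1 - Complex.exp ((y - x : ℝ) * Complex.I))).im = (y - x - Real.pi) / 2 ∧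
      (Complex.log (1 - Complex.exp ((x - y : ℝ) * Complex.I))).im = -((y - x - Real.pi) / 2) := by
    intro x y h1 h2
    have e1 := arg_one_sub_exp h1 h2
    refine ⟨by rw [Complex.log_im, e1], ?_⟩
    rw [Complex.log_im, ← e1, ← arg_one_sub_inv (Complex.norm_exp_ofReal_mul_I _),
      ← Complex.exp_neg]
    · congr 3; push_cast; ring
    · intro h
      rw [h] at e1
      simp at e1
      have := Complex.exp_eq_one_iff.1 h
      obtain ⟨n, hn⟩ := this
      have hn' : ((y - x : ℝ) : ℂ) = ((n * (2 * Real.pi) : ℝ) : ℂ) := by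
        have := mul_right_cancel₀ Complex.I_ne_zero
          (show ((y - x : ℝ) : ℂ) * Complex.I = ((n * (2 * Real.pi) : ℝ) : ℂ) * Complex.I by
            rw [hn]; push_cast; ring)
        exact this
      have hn2 : y - x = n * (2 * Real.pi) := by exact_mod_cast hn'
      have h3 : (0 : ℝ) < n := by
        by_contra! h'
        nlinarith
      have h4 : (n : ℝ) < 1 := by
        by_contra! h'
        nlinarith
      have h5 : (0 : ℤ) < n := by exact_mod_cast h3
      have h6 : n < (1 : ℤ) := by exact_mod_cast h4
      omega
  -- By these angles, the two ways from corner `(0, 0)` to corner `(1, 1)` change the imaginary part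
  -- of `F` by amounts that differ by `2π`.
  have i0 := congrArg Complex.im s0
  have i1 := congrArg Complex.im s1
  have j0 := congrArg Complex.im t0
  have j1 := congrArg Complex.im t1
  simp only [Complex.sub_im] at i0 i1 j0 j1
  rw [(hA α δ (by linarith) (by linarith)).1, (hA α β (by linarith) (by linarith)).1] at i0
  rw [(hA γ δ (by linarith) (by linarith)).1, (hA β γ (by linarith) (by linarith)).2] at i1
  rw [(hA β γ (by linarith) (by linarith)).1, (hA α β (by linarith) (by linarith)).2] at j0
  rw [(hA γ δ (by linarith) (by linarith)).2, (hA α δ (by linarith) (by linarith)).2] at j1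
  linarith

end Topology

/-- The edges of `G`, drawn as arcs above the line on which the vertices are placed in the given
order, do not cross. -/
def IsNonCrossing {V : Type*} [LinearOrder V] (G : SimpleGraph V) : Prop :=
  ∀ a b c d : V, a < b → b < c → c < d → G.Adj a c → ¬ G.Adj b d

/-- Order the vertices by argument. Arcs of interleaved edges would meet, and could do so only in a
common end, but the four ends are distinct. -/
theorem IsOuterplanar.exists_linearOrder {V : Type*} {G : SimpleGraph V} (h : G.IsOuterplanar) :
    ∃ _ : LinearOrder V, G.IsNonCrossing := by
  obtain ⟨D⟩ := h
  have hexp : ∀ v, Complex.exp ((D.pos v).arg * Complex.I) = D.pos v := fun v => by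
    have h1 : ‖D.pos v‖ = 1 := by simpa using D.pos_mem_circle v
    have := Complex.norm_mul_exp_arg_mul_I (D.pos v)
    rwa [h1, Complex.ofReal_one, one_mul] at this
  have hinj : Function.Injective fun v => (D.pos v).arg := fun u v huv => D.pos_injective <| by
    rw [← hexp u, ← hexp v]; exact congrArg (fun x : ℝ => Complex.exp (x * Complex.I)) huv
  refine ⟨LinearOrder.lift' _ hinj, ?_⟩
  intro a b c d hab hbc hcd hac hbd
  change (D.pos a).arg < (D.pos b).arg at hab
  change (D.pos b).arg < (D.pos c).arg at hbc
  change (D.pos c).arg < (D.pos d).arg at hcd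
  obtain ⟨p, -, hp⟩ := D.arc_isArc a c hac
  obtain ⟨q, -, hq⟩ := D.arc_isArc b d hbd
  have hp' : ∀ s, p s ∈ D.arc s(a, c) := fun s => hp ▸ Set.mem_range_self s
  have hq' : ∀ s, q s ∈ D.arc s(b, d) := fun s => hq ▸ Set.mem_range_self s
  obtain ⟨s, t, hst⟩ := exists_eq_of_interleaved hab hbc hcd
    (by linarith [(D.pos d).arg_le_pi, (D.pos a).neg_pi_lt_arg])
    (p.cast (hexp a) (hexp c)) (q.cast (hexp b) (hexp d))
    (fun s => by simpa using D.arc_subset_disc _ hac (hp' s))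
    (fun s => by simpa using D.arc_subset_disc _ hbd (hq' s))
  have hne : a ≠ b ∧ a ≠ d ∧ c ≠ b ∧ c ≠ d := by
    refine ⟨?_, ?_, ?_, ?_⟩ <;> rintro rfl <;> linarith
  have hst' : p s = q t := hst
  obtain ⟨v, hv1, hv2, -⟩ := D.arcs_meet _ hac _ hbd
    (by simp only [ne_eq, Sym2.eq_iff]; tauto) (p s) (hp' s) (hst' ▸ hq' t)
  rw [Sym2.mem_iff] at hv1 hv2
  rcases hv1 with rfl | rfl <;> rcases hv2 with rfl | rfl <;> tauto

end SimpleGraph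

/-! ### From sets of possible positions to cop strategies -/

namespace SimpleGraph

variable {V : Type*} {G : SimpleGraph V}

/-- The vertices of `S` together with their neighbors. -/
def closedNeighbors (G : SimpleGraph V) (S : Set V) : Set V :=
  {y | ∃ x ∈ S, y = x ∨ G.Adj x y}

theorem subset_closedNeighbors (S : Set V) : S ⊆ G.closedNeighbors S := fun x hx => ⟨x, hx, .inl rfl⟩

theorem closedNeighbors_mono {S S' : Set V} (h : S ⊆ S') :
    G.closedNeighbors S ⊆ G.closedNeighbors S' := fun _ ⟨x, hx, hy⟩ => ⟨x, h hx, hy⟩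

/-- The vertices of `S` whose distances to the probed vertices `c` are given by `p`. -/
def probeClass (G : SimpleGraph V) {k : ℕ} (c : Fin k → V) (p : Fin k → ℕ) (S : Set V) : Set V :=
  {x | x ∈ S ∧ (fun j => G.dist (c j) x) = p}

/-- `k` cops who know that the robber is in `S` before their next probe can locate him within `T`
rounds. -/
def WinFrom (G : SimpleGraph V) (k : ℕ) : ℕ → Set V → Prop
  | 0, S => S.Subsingleton
  | T + 1, S => ∃ c : Fin k → V, ∀ p : Fin k → ℕ, (G.probeClass c p S).Subsingleton ∨
      WinFrom G k T (G.closedNeighbors (G.probeClass c p S))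

theorem probeClass_mono {k : ℕ} (c : Fin k → V) (p : Fin k → ℕ) {S S' : Set V} (h : S ⊆ S') :
    G.probeClass c p S ⊆ G.probeClass c p S' := fun _ hx => ⟨h hx.1, hx.2⟩

theorem WinFrom.mono_set {k T : ℕ} {S S' : Set V} (hS : S ⊆ S') (h : G.WinFrom k T S') :
    G.WinFrom k T S := by
  induction T generalizing S S' with
  | zero => exact Set.Subsingleton.anti h hS
  | succ T ih =>
    obtain ⟨c, hc⟩ := h
    exact ⟨c, fun p => (hc p).imp (fun h => h.anti (probeClass_mono c p hS))
      (ih (closedNeighbors_mono (probeClass_mono c p hS)))⟩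

theorem WinFrom.succ [Nonempty V] {k T : ℕ} {S : Set V} (h : G.WinFrom k T S) :
    G.WinFrom k (T + 1) S := by
  induction T generalizing S with
  | zero => exact ⟨fun _ => Classical.arbitrary V, fun p => .inl <|
      Set.Subsingleton.anti h fun x hx => hx.1⟩
  | succ T ih =>
    obtain ⟨c, hc⟩ := h
    exact ⟨c, fun p => (hc p).imp_right ih⟩

theorem WinFrom.mono_time [Nonempty V] {k T T' : ℕ} {S : Set V} (hT : T ≤ T')
    (h : G.WinFrom k T S) : G.WinFrom k T' S := by
  induction hT with
  | refl => exact h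
  | step _ ih => exact ih.succ

/-- `answers` recurses on the last round, whereas `WinFrom` recurses on the first. -/
theorem answers_succ_eq_cons {k : ℕ} (σ : CopStrategy V k) (r : ℕ → V) (t : ℕ) :
    answers G σ r (t + 1) = (fun j => G.dist (σ [] j) (r 0)) ::
      answers G (fun l => σ ((fun j => G.dist (σ [] j) (r 0)) :: l)) (fun i => r (i + 1)) t := by
  induction t with
  | zero => rfl
  | succ t ih =>
    rw [answers, ih]
    rfl

theorem IsTrajectory.tail {r : ℕ → V} (h : G.IsTrajectory r) :
    G.IsTrajectory fun i => r (i + 1) := fun i => h (i + 1)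

theorem isTrajectory_const (v : V) : G.IsTrajectory fun _ => v := fun _ => .inl rfl

theorem WinFrom.exists_strategy [Nonempty V] {k T : ℕ} {S : Set V} (h : G.WinFrom k T S) :
    ∃ σ : CopStrategy V k, ∀ r : ℕ → V, G.IsTrajectory r → r 0 ∈ S → ∃ t ≤ T,
      ∀ r' : ℕ → V, G.IsTrajectory r' → r' 0 ∈ S → answers G σ r' t = answers G σ r t →
        r' (t - 1) = r (t - 1) := by
  induction T generalizing S with
  | zero =>
    exact ⟨fun _ _ => Classical.arbitrary V, fun r _ hr => ⟨0, le_rfl, fun r' _ hr' _ => h hr' hr⟩⟩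
  | succ T ih =>
    obtain ⟨c, hc⟩ := h
    have hσ : ∀ p : Fin k → ℕ, ∃ σ : CopStrategy V k, ¬ (G.probeClass c p S).Subsingleton →
        ∀ r : ℕ → V, G.IsTrajectory r → r 0 ∈ G.closedNeighbors (G.probeClass c p S) → ∃ t ≤ T,
        ∀ r' : ℕ → V, G.IsTrajectory r' → r' 0 ∈ G.closedNeighbors (G.probeClass c p S) →
          answers G σ r' t = answers G σ r t → r' (t - 1) = r (t - 1) := by
      intro p
      by_cases hp : (G.probeClass c p S).Subsingleton
      · exact ⟨fun _ _ => Classical.arbitrary V, fun h => absurd hp h⟩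
      · obtain ⟨σ, hσ⟩ := ih ((hc p).resolve_left hp)
        exact ⟨σ, fun _ => hσ⟩
    choose τ hτ using hσ
    refine ⟨fun l => match l with
      | [] => c
      | p :: l => τ p l, fun r hr hrS => ?_⟩
    have hcl : ∀ r' : ℕ → V, G.IsTrajectory r' → ∀ p, r' 0 ∈ G.probeClass c p S →
        r' 1 ∈ G.closedNeighbors (G.probeClass c p S) := fun r' hr' p h => ⟨_, h, hr' 0⟩
    have hr0 : r 0 ∈ G.probeClass c (fun j => G.dist (c j) (r 0)) S := ⟨hrS, rfl⟩
    by_cases hp : (G.probeClass c (fun j => G.dist (c j) (r 0)) S).Subsingleton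
    · refine ⟨1, by omega, fun r' _ hr'S hans => hp ⟨hr'S, ?_⟩ hr0⟩
      simp only [answers_succ_eq_cons] at hans
      exact (List.cons.inj hans).1
    · obtain ⟨t, ht, hloc⟩ := hτ _ hp (fun i => r (i + 1)) hr.tail (hcl r hr _ hr0)
      refine ⟨t + 1, by omega, fun r' hr' hr'S hans => ?_⟩
      simp only [answers_succ_eq_cons] at hans
      obtain ⟨h1, h2⟩ := List.cons.inj hans
      have hr'0 : r' 0 ∈ G.probeClass c (fun j => G.dist (c j) (r 0)) S := ⟨hr'S, h1⟩
      rw [h1] at h2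
      -- With no further probe, `hloc` speaks of the position after the move, but the position
      -- before it is wanted. Constant trajectories bridge the gap, as staying is a legal move.
      rcases t with _ | t
      · have e1 := hloc (fun _ => r 0) (isTrajectory_const _) (subset_closedNeighbors _ hr0) rfl
        have e2 := hloc (fun _ => r' 0) (isTrajectory_const _) (subset_closedNeighbors _ hr'0) rfl
        exact e2.trans e1.symm
      · exact hloc (fun i => r' (i + 1)) hr'.tail (hcl r' hr' _ hr'0) h2

theorem WinFrom.copsWinWithin [Nonempty V] {k T : ℕ} (h : G.WinFrom k T Set.univ) :
    G.CopsWinWithin k T := by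
  obtain ⟨σ, hσ⟩ := h.exists_strategy
  refine ⟨σ, fun r hr => ?_⟩
  obtain ⟨t, ht, h⟩ := hσ r hr trivial
  exact ⟨t, ht, fun r' hr' => h r' hr' trivial⟩

theorem CopsWinWithin.captureTime_le {k T : ℕ} (h : G.CopsWinWithin k T) :
    G.kLocalizationCaptureTime k ≤ T :=
  iInf₂_le (f := fun (T : ℕ) (_ : T ∈ {T : ℕ | G.CopsWinWithin k T}) => (T : ℕ∞)) T h

/-! ### Counting vertices by blocks -/

theorem Subgraph.Connected.exists_small_spanning_le [Finite V] {H : G.Subgraph}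
    (hH : H.Connected) : ∃ F : SimpleGraph V, F ≤ G ∧ F.edgeSet.ncard ≤ H.verts.ncard - 1 ∧
      ∀ u v, H.Adj u v → F.Reachable u v := by
  obtain ⟨T, hT, hTree⟩ := hH.coe.exists_isTree_le
  refine ⟨T.map (Function.Embedding.subtype _), ?_, ?_, ?_⟩
  · rw [SimpleGraph.map_le_iff_le_comap]
    intro u v h
    exact (hT h).adj_sub
  · classical
    have := Fintype.ofFinite H.verts
    have h1 := hTree.card_edgeFinset
    rw [SimpleGraph.edgeSet_map, Set.ncard_image_of_injective _
      (Function.Embedding.subtype _).sym2Map.injective, Set.ncard_eq_toFinset_card']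
    have h2 : H.verts.ncard = Fintype.card H.verts := by
      rw [← Nat.card_coe_set_eq, Nat.card_eq_fintype_card]
    have h3 : T.edgeSet.toFinset.card = T.edgeFinset.card := by simp only [edgeFinset]
    rw [h3, h2, ← h1, Nat.add_sub_cancel]
  · intro u v h
    have := hTree.connected ⟨u, h.fst_mem⟩ ⟨v, h.snd_mem⟩
    exact this.map (Embedding.map _ T).toHom

/-- The union of the spanning trees connects all of `V`, so it has at least `|V| - 1` edges. -/
theorem Connected.card_sub_one_le_sum [Finite V] (hG : G.Connected) {ι : Type*} [Fintype ι]
    (B : ι → G.Subgraph) (hB : ∀ i, (B i).Connected) (hcover : (⨆ i, B i) = ⊤) :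
    Nat.card V - 1 ≤ ∑ i, ((B i).verts.ncard - 1) := by
  choose F hF hcard hreach using fun i => (hB i).exists_small_spanning_le
  have hle : ∀ i, F i ≤ ⨆ i, F i := le_iSup F
  have hadj : ∀ u v, G.Adj u v → (⨆ i, F i).Reachable u v := by
    intro u v huv
    have : (⨆ i, B i).Adj u v := by rw [hcover]; exact huv
    obtain ⟨i, hi⟩ := Subgraph.iSup_adj.1 this
    exact (hreach i u v hi).mono (hle i)
  have hconn : (⨆ i, F i).Connected := by
    have := hG.nonempty
    refine ⟨fun u v => ?_⟩
    obtain ⟨w⟩ := hG.preconnected u v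
    induction w with
    | nil => rfl
    | cons h _ ih => exact (hadj _ _ h).trans ih
  have h1 := hconn.card_vert_le_card_edgeSet_add_one
  have h2 : Nat.card (⨆ i, F i).edgeSet ≤ ∑ i, (F i).edgeSet.ncard := by
    rw [Nat.card_coe_set_eq, edgeSet_iSup]
    exact Set.ncard_iUnion_le_of_fintype _
  have h3 := Finset.sum_le_sum fun i (_ : i ∈ Finset.univ) => hcard i
  omega

end SimpleGraph

/-! ### Geodesics in non-crossing graphs -/

namespace SimpleGraph

variable {V : Type*} {G : SimpleGraph V}

theorem Connected.dist_eq_add_of_mem_support (hc : G.Connected) {u v g : V} {p : G.Walk u v}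
    (hp : p.length = G.dist u v) (hg : g ∈ p.support) :
    G.dist u v = G.dist u g + G.dist g v := by
  classical
  have h1 := congrArg Walk.length (p.take_spec hg)
  rw [Walk.length_append] at h1
  have h2 := dist_le (p.takeUntil g hg)
  have h3 := dist_le (p.dropUntil g hg)
  have h4 := hc.dist_triangle (u := u) (v := g) (w := v)
  omega

theorem exists_geodesic_of_mem_support {u v g : V} {p : G.Walk u v}
    (hp : p.length = G.dist u v) (hg : g ∈ p.support) :
    ∃ q : G.Walk g v, q.length = G.dist g v ∧ q.support ⊆ p.support := by
  classical
  exact ⟨p.dropUntil g hg, length_eq_dist_of_subwalk hp (p.isSubwalk_dropUntil hg),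
    p.support_dropUntil_subset_support hg⟩

theorem exists_geodesic_of_mem_support_of_mem_support {u v g h : V}
    {p : G.Walk u v} (hp : p.length = G.dist u v) (hg : g ∈ p.support) (hh : h ∈ p.support) :
    ∃ q : G.Walk g h, q.length = G.dist g h ∧ q.support ⊆ p.support := by
  classical
  rw [← p.take_spec hg, Walk.mem_support_append_iff] at hh
  rcases hh with hh | hh
  · have h1 := length_eq_dist_of_subwalk hp (p.isSubwalk_takeUntil hg)
    obtain ⟨q, hq, hqs⟩ := exists_geodesic_of_mem_support h1 hh
    refine ⟨q.reverse, by rw [Walk.length_reverse, hq, dist_comm], fun x hx => ?_⟩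
    rw [Walk.support_reverse, List.mem_reverse] at hx
    exact p.support_takeUntil_subset_support hg (hqs hx)
  · have h1 := length_eq_dist_of_subwalk hp (p.isSubwalk_dropUntil hg)
    exact ⟨(p.dropUntil g hg).takeUntil h hh,
      length_eq_dist_of_subwalk h1 (Walk.isSubwalk_takeUntil _ hh),
      fun x hx => p.support_dropUntil_subset_support hg
        (Walk.support_takeUntil_subset_support _ hh hx)⟩

theorem dist_le_one_of_eq_or_adj {x y : V} (h : y = x ∨ G.Adj x y) : G.dist x y ≤ 1 := by
  rcases h with rfl | h
  · simp
  · exact (dist_eq_one_iff_adj.2 h).le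

variable [LinearOrder V]

theorem IsNonCrossing.mem_support_of_chord (hG : G.IsNonCrossing) {s t b d : V}
    (hst : G.Adj s t) (hb : b ∈ Set.Ioo s t) (hd : d ∉ Set.Ioo s t) (p : G.Walk b d) :
    s ∈ p.support ∨ t ∈ p.support := by
  obtain ⟨e, he, h1, h2⟩ := p.exists_boundary_dart (Set.Ioo s t) hb hd
  have hmem := p.dart_snd_mem_support_of_mem_darts he
  rcases lt_trichotomy e.snd s with h | h | h
  · exact absurd hst (hG _ _ _ _ h h1.1 h1.2 e.adj.symm)
  · exact .inl (h ▸ hmem)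
  rcases lt_trichotomy e.snd t with h' | h' | h'
  · exact absurd ⟨h, h'⟩ h2
  · exact .inr (h' ▸ hmem)
  · exact absurd e.adj (hG _ _ _ _ h1.1 h1.2 h' hst)

/-- In a non-crossing graph, two walks whose ends interleave share a vertex. -/
theorem IsNonCrossing.exists_mem_support (hG : G.IsNonCrossing) {a b c d : V} (hab : a < b)
    (hbc : b < c) (hcd : c < d) (p : G.Walk a c) (q : G.Walk b d) :
    ∃ g ∈ p.support, g ∈ q.support := by
  by_contra! hdisj
  -- An edge of `p` that enters `(b, d)` from outside is a chord separating `b` from `d`, so `q`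
  -- must use one of its ends.
  obtain ⟨e, he, h1, h2⟩ := p.exists_boundary_dart (Set.Ioo b d)ᶜ
    (fun h => lt_asymm h.1 hab) (fun h => h ⟨hbc, hcd⟩)
  rw [Set.mem_compl_iff, not_not] at h2
  have hf := hdisj _ (p.dart_fst_mem_support_of_mem_darts he)
  have hs := hdisj _ (p.dart_snd_mem_support_of_mem_darts he)
  rcases lt_or_ge e.fst b with h | h
  · rcases hG.mem_support_of_chord e.adj ⟨h, h2.1⟩ (fun h => lt_asymm h.2 h2.2) q with h | h
    exacts [hf h, hs h]
  · have h3 : d ≤ e.fst := by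
      by_contra! h3
      rcases h.lt_or_eq with h | h
      · exact h1 ⟨h, h3⟩
      · exact hf (h ▸ q.start_mem_support)
    have h4 : d < e.fst := h3.lt_of_ne fun h => hf (h ▸ q.end_mem_support)
    rcases hG.mem_support_of_chord e.adj.symm ⟨h2.2, h4⟩ (fun h => lt_asymm h.1 h2.1) q.reverse
      with h | h <;> rw [Walk.support_reverse, List.mem_reverse] at h
    exacts [hs h, hf h]

theorem IsNonCrossing.dist_chord (hG : G.IsNonCrossing) (hc : G.Connected) {s t b d : V}
    (hst : G.Adj s t) (hb : b ∈ Set.Icc s t) (hd : d ∉ Set.Ioo s t) :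
    G.dist b d = G.dist b s + G.dist s d ∨ G.dist b d = G.dist b t + G.dist t d := by
  rcases hb.1.eq_or_lt with rfl | h1
  · simp
  rcases hb.2.eq_or_lt with rfl | h2
  · simp
  obtain ⟨p, hp⟩ := hc.exists_walk_length_eq_dist b d
  exact (hG.mem_support_of_chord hst ⟨h1, h2⟩ hd p).imp (hc.dist_eq_add_of_mem_support hp)
    (hc.dist_eq_add_of_mem_support hp)

theorem IsNonCrossing.exists_dist_eq_add (hG : G.IsNonCrossing) (hc : G.Connected) {a b c d : V}
    (hab : a < b) (hbc : b < c) (hcd : c < d) :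
    ∃ g, G.dist a c = G.dist a g + G.dist g c ∧ G.dist b d = G.dist b g + G.dist g d := by
  obtain ⟨p, hp⟩ := hc.exists_walk_length_eq_dist a c
  obtain ⟨q, hq⟩ := hc.exists_walk_length_eq_dist b d
  obtain ⟨g, hgp, hgq⟩ := hG.exists_mem_support hab hbc hcd p q
  exact ⟨g, hc.dist_eq_add_of_mem_support hp hgp, hc.dist_eq_add_of_mem_support hq hgq⟩

/-- A vertex of the interval `[u, v]` that lies on a geodesic from `u` to `v` is determined by its
distances to `u` and `v`. -/
theorem IsNonCrossing.eq_of_dist_eq (hG : G.IsNonCrossing) (hc : G.Connected) {u v g s : V}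
    (hg : g ∈ Set.Icc u v) (hs : s ∈ Set.Icc u v)
    (hgeo : G.dist g u + G.dist g v = G.dist u v) (hu : G.dist s u = G.dist g u)
    (hv : G.dist s v = G.dist g v) : s = g := by
  rcases hs.1.eq_or_lt with rfl | hs1
  · exact ((hc.dist_eq_zero_iff).1 (by rw [← hu, dist_self])).symm
  rcases hs.2.eq_or_lt with rfl | hs2
  · exact ((hc.dist_eq_zero_iff).1 (by rw [← hv, dist_self])).symm
  rcases hg.1.eq_or_lt with rfl | hg1
  · exact (hc.dist_eq_zero_iff).1 (by rw [hu, dist_self])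
  rcases hg.2.eq_or_lt with rfl | hg2
  · exact (hc.dist_eq_zero_iff).1 (by rw [hv, dist_self])
  -- When `s ≠ g`, two of the geodesics interleave and meet at some `k`; passing from `u` to `v`
  -- through `k` would beat `d(u, v)` unless `s = k = g`.
  rcases lt_trichotomy s g with h | h | h
  · obtain ⟨k, h1, h2⟩ := hG.exists_dist_eq_add hc hs1 h hg2
    have h3 := hc.dist_triangle (u := u) (v := k) (w := v)
    rw [dist_comm (u := u) (v := g)] at h1
    have h4 : G.dist k g = 0 := by omega
    have h5 : G.dist s k = 0 := by omega
    rw [hc.dist_eq_zero_iff] at h4 h5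
    rw [h5, h4]
  · exact h
  · obtain ⟨k, h1, h2⟩ := hG.exists_dist_eq_add hc hg1 h hs2
    have h3 := hc.dist_triangle (u := u) (v := k) (w := v)
    rw [dist_comm (u := u) (v := s)] at h1
    have h4 : G.dist k s = 0 := by omega
    have h5 : G.dist g k = 0 := by omega
    rw [hc.dist_eq_zero_iff] at h4 h5
    rw [h5, h4]

/-- Some geodesic from `u` to `v` stays in the interval `[u, v]`. -/
def IsGeodesicInterval (G : SimpleGraph V) (u v : V) : Prop :=
  ∃ p : G.Walk u v, p.length = G.dist u v ∧ ∀ x ∈ p.support, x ∈ Set.Icc u v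

theorem Adj.isGeodesicInterval {u v : V} (h : G.Adj u v) (huv : u < v) :
    G.IsGeodesicInterval u v := by
  refine ⟨h.toWalk, by simp [dist_eq_one_iff_adj.2 h], fun x hx => ?_⟩
  simp only [Adj.toWalk, Walk.support_cons, Walk.support_nil, List.mem_cons, List.not_mem_nil,
    or_false] at hx
  rcases hx with rfl | rfl
  exacts [⟨le_rfl, huv.le⟩, ⟨huv.le, le_rfl⟩]

/-- `S` is contained in a geodesic interval that is strictly smaller than `[u, v]`. -/
def Shrinks (G : SimpleGraph V) (u v : V) (S : Set V) : Prop :=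
  ∃ u' v', G.IsGeodesicInterval u' v' ∧ S ⊆ Set.Icc u' v' ∧ Set.Icc u' v' ⊂ Set.Icc u v

/-- `p` may stick out of `[y, z]`, so the new interval is spanned by the least and greatest vertices
of `p`; the part of `p` between these is again a geodesic. -/
theorem shrinks_of_geodesic {u v y z : V} {S : Set V}
    (hS : S ⊆ Set.Icc y z) (huv : u ≤ v) (p : G.Walk y z) (hp : p.length = G.dist y z)
    (hsub : ∀ x ∈ p.support, x ∈ Set.Icc u v) (hav : u ∉ p.support ∨ v ∉ p.support) :
    G.Shrinks u v S := by
  have hne : p.support.toFinset.Nonempty := ⟨y, by simp⟩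
  obtain ⟨l, hl, hlmin⟩ := p.support.toFinset.exists_min_image id hne
  obtain ⟨m, hm, hmmax⟩ := p.support.toFinset.exists_max_image id hne
  simp only [List.mem_toFinset, id] at hl hlmin hm hmmax
  obtain ⟨q, hq, hqs⟩ := exists_geodesic_of_mem_support_of_mem_support hp hl hm
  refine ⟨l, m, ⟨q, hq, fun x hx => ⟨hlmin x (hqs hx), hmmax x (hqs hx)⟩⟩,
    hS.trans (Set.Icc_subset_Icc (hlmin y p.start_mem_support) (hmmax z p.end_mem_support)),
    Set.Icc_subset_Icc (hsub l hl).1 (hsub m hm).2, fun h => ?_⟩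
  rcases hav with h' | h'
  · have := (h ⟨le_rfl, huv⟩).1
    exact h' (le_antisymm this (hsub l hl).1 ▸ hl)
  · have := (h ⟨huv, le_rfl⟩).2
    exact h' (le_antisymm this (hsub m hm).2 ▸ hm)

/-- The walk `p` is a barrier: an edge from `s` out of the interval would interleave with `p` and
share a vertex with it. -/
theorem IsNonCrossing.mem_Icc_of_adj (hG : G.IsNonCrossing) {u v s r : V} {p : G.Walk u v}
    (hs : s ∈ Set.Icc u v) (hsp : s ∉ p.support) (hp : ∀ x ∈ p.support, x ∈ Set.Icc u v)
    (h : G.Adj s r) : r ∈ Set.Icc u v := by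
  have h1 : u < s := hs.1.lt_of_ne fun h => hsp (h ▸ p.start_mem_support)
  have h2 : s < v := hs.2.lt_of_ne fun h => hsp (h ▸ p.end_mem_support)
  by_contra hr
  have key : ∀ g ∈ p.support, g ∉ h.toWalk.support := by
    intro g hg hg'
    simp only [Adj.toWalk, Walk.support_cons, Walk.support_nil, List.mem_cons, List.not_mem_nil,
      or_false] at hg'
    rcases hg' with rfl | rfl
    exacts [hsp hg, hr (hp _ hg)]
  rcases lt_or_ge r u with h3 | h3
  · obtain ⟨g, hg, hg'⟩ := hG.exists_mem_support h3 h1 h2 h.toWalk.reverse p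
    rw [Walk.support_reverse, List.mem_reverse] at hg
    exact key g hg' hg
  · have h4 : v < r := by
      by_contra! h4
      exact hr ⟨h3, h4⟩
    obtain ⟨g, hg, hg'⟩ := hG.exists_mem_support h1 h2 h4 p h.toWalk
    exact key g hg hg'

/-- Follow a geodesic to `t` until it first meets `p`, then continue along `p`. It cannot leave `I`
before that. -/
theorem Connected.exists_geodesic_subset (hc : G.Connected) {s t y : V} {I : Set V}
    (p : G.Walk s t) (hp : p.length = G.dist s t) (hpI : ∀ x ∈ p.support, x ∈ I)
    (hI : ∀ x ∈ I, x ∉ p.support → ∀ r, G.Adj x r → r ∈ I) (hy : y ∈ I) :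
    ∃ q : G.Walk y t, q.length = G.dist y t ∧ ∀ x ∈ q.support, x ∈ I := by
  have key : ∀ (z w : V) (q : G.Walk z w), w = t → z ∈ I →
      ∃ q' : G.Walk z t, q'.length ≤ q.length ∧ ∀ x ∈ q'.support, x ∈ I := by
    intro z w q
    induction q with
    | nil =>
      rintro rfl hz
      exact ⟨.nil, le_rfl, by simpa using hz⟩
    | @cons a b c h q ih =>
      rintro rfl ha
      by_cases hap : a ∈ p.support
      · obtain ⟨q', hq', hs⟩ := exists_geodesic_of_mem_support hp hap
        exact ⟨q', hq'.trans_le (dist_le _), fun x hx => hpI x (hs hx)⟩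
      · obtain ⟨q', hq', hs⟩ := ih rfl (hI a ha hap b h)
        refine ⟨.cons h q', by simpa using hq', fun x hx => ?_⟩
        rw [Walk.support_cons, List.mem_cons] at hx
        rcases hx with rfl | hx
        exacts [ha, hs x hx]
  obtain ⟨q, hq⟩ := hc.exists_walk_length_eq_dist y t
  obtain ⟨q', hq', hs⟩ := key y t q rfl hy
  exact ⟨q', le_antisymm (hq'.trans_eq hq) (dist_le _), hs⟩

theorem IsNonCrossing.exists_geodesic_right (hG : G.IsNonCrossing) (hc : G.Connected) {u v y : V}
    (h : G.IsGeodesicInterval u v) (hy : y ∈ Set.Icc u v) :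
    ∃ q : G.Walk y v, q.length = G.dist y v ∧ ∀ x ∈ q.support, x ∈ Set.Icc u v := by
  obtain ⟨p, hp, hps⟩ := h
  exact hc.exists_geodesic_subset p hp hps
    (fun x hx hxp r hr => hG.mem_Icc_of_adj hx hxp hps hr) hy

theorem IsNonCrossing.exists_geodesic_left (hG : G.IsNonCrossing) (hc : G.Connected) {u v y : V}
    (h : G.IsGeodesicInterval u v) (hy : y ∈ Set.Icc u v) :
    ∃ q : G.Walk y u, q.length = G.dist y u ∧ ∀ x ∈ q.support, x ∈ Set.Icc u v := by
  obtain ⟨p, hp, hps⟩ := h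
  refine hc.exists_geodesic_subset p.reverse (by rw [Walk.length_reverse, hp, dist_comm])
    (by simpa using hps) (fun x hx hxp r hr => ?_) hy
  rw [Walk.support_reverse, List.mem_reverse] at hxp
  exact hG.mem_Icc_of_adj hx hxp hps hr

/-- The strict inequality says that no geodesic from `y` to `v` passes `u`. Used contrapositively:
without shrinking, the least possible position reaches `v` optimally through `u`. -/
theorem IsNonCrossing.shrinks_left (hG : G.IsNonCrossing) (hc : G.Connected) {u v y : V}
    {S : Set V} (h : G.IsGeodesicInterval u v) (hy : y ∈ Set.Icc u v) (hS : S ⊆ Set.Icc y v)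
    (hlt : G.dist y v < G.dist y u + G.dist u v) : G.Shrinks u v S := by
  obtain ⟨q, hq, hqs⟩ := hG.exists_geodesic_right hc h hy
  exact shrinks_of_geodesic hS (hy.1.trans hy.2) q hq hqs
    (.inl fun hu => hlt.ne (hc.dist_eq_add_of_mem_support hq hu))

theorem IsNonCrossing.shrinks_left_of_adj (hG : G.IsNonCrossing) (hc : G.Connected) {u v x y : V}
    {S : Set V} (h : G.IsGeodesicInterval u v) (hy : y ∈ Set.Icc u v) (hx : x ∈ Set.Icc u v)
    (hS : S ⊆ Set.Icc y v) (hyx : G.Adj y x) (hyu : y ≠ u)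
    (hlt : G.dist x v < G.dist x u + G.dist u v) (heq : G.dist y v = G.dist x v + 1) :
    G.Shrinks u v S := by
  obtain ⟨q, hq, hqs⟩ := hG.exists_geodesic_right hc h hx
  refine shrinks_of_geodesic hS (hy.1.trans hy.2) (.cons hyx q)
    (by rw [Walk.length_cons, hq, heq]) (fun r hr => ?_) (.inl fun hr => ?_) <;>
    rw [Walk.support_cons, List.mem_cons] at hr <;> rcases hr with hr | hr
  · exact hr ▸ hy
  · exact hqs r hr
  · exact hyu hr.symm
  · exact hlt.ne (hc.dist_eq_add_of_mem_support hq hr)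

theorem IsNonCrossing.shrinks_right (hG : G.IsNonCrossing) (hc : G.Connected) {u v z : V}
    {S : Set V} (h : G.IsGeodesicInterval u v) (hz : z ∈ Set.Icc u v) (hS : S ⊆ Set.Icc u z)
    (hlt : G.dist z u < G.dist z v + G.dist u v) : G.Shrinks u v S := by
  obtain ⟨q, hq, hqs⟩ := hG.exists_geodesic_left hc h hz
  refine shrinks_of_geodesic hS (hz.1.trans hz.2) q.reverse
    (by rw [Walk.length_reverse, hq, dist_comm]) (by simpa using hqs) (.inr fun hv => ?_)
  rw [Walk.support_reverse, List.mem_reverse] at hv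
  have := hc.dist_eq_add_of_mem_support hq hv
  rw [dist_comm (u := v) (v := u)] at this
  omega

/-- If the geodesic `p` does not contain both ends of the chord `uv`, then it stays in
`[u, v]`. -/
theorem IsNonCrossing.shrinks_chord (hG : G.IsNonCrossing) (hc : G.Connected) {u v y z : V}
    {S : Set V} (huv : G.Adj u v) (hy : y ∈ Set.Icc u v) (hz : z ∈ Set.Icc u v)
    (hS : S ⊆ Set.Icc y z) (p : G.Walk y z) (hp : p.length = G.dist y z)
    (hav : u ∉ p.support ∨ v ∉ p.support) : G.Shrinks u v S := by
  have hd : ∀ x ∈ Set.Icc u v, ∀ r ∉ Set.Icc u v, ∀ q : G.Walk x r, q.length = G.dist x r →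
      q.support ⊆ p.support → (u ∈ p.support ∧ G.dist x r = G.dist x u + G.dist u r) ∨
      (v ∈ p.support ∧ G.dist x r = G.dist x v + G.dist v r) := by
    intro x hx r hr q hq hqs
    have hmem : u ∈ q.support ∨ v ∈ q.support := by
      rcases hx.1.eq_or_lt with rfl | h1
      · exact .inl q.start_mem_support
      rcases hx.2.eq_or_lt with rfl | h2
      · exact .inr q.start_mem_support
      exact hG.mem_support_of_chord huv ⟨h1, h2⟩ (fun h => hr ⟨h.1.le, h.2.le⟩) q
    exact hmem.imp (fun h => ⟨hqs h, hc.dist_eq_add_of_mem_support hq h⟩)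
      (fun h => ⟨hqs h, hc.dist_eq_add_of_mem_support hq h⟩)
  refine shrinks_of_geodesic hS (hy.1.trans hy.2) p hp (fun r hr => ?_) hav
  by_contra hrI
  obtain ⟨q₁, hq₁, hs₁⟩ :=
    exists_geodesic_of_mem_support_of_mem_support hp p.start_mem_support hr
  obtain ⟨q₂, hq₂, hs₂⟩ :=
    exists_geodesic_of_mem_support_of_mem_support hp p.end_mem_support hr
  have h0 := hc.dist_eq_add_of_mem_support hp hr
  rw [dist_comm (u := r) (v := z)] at h0
  have hru : 0 < G.dist u r :=
    hc.pos_dist_of_ne fun h => hrI (h ▸ ⟨le_rfl, hy.1.trans hy.2⟩)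
  have hrv : 0 < G.dist v r :=
    hc.pos_dist_of_ne fun h => hrI (h ▸ ⟨hy.1.trans hy.2, le_rfl⟩)
  have t1 := hc.dist_triangle (u := y) (v := u) (w := z)
  have t2 := hc.dist_triangle (u := y) (v := v) (w := z)
  rw [dist_comm (u := u) (v := z)] at t1
  rw [dist_comm (u := v) (v := z)] at t2
  rcases hd y hy r hrI q₁ hq₁ hs₁ with ⟨hm, h1⟩ | ⟨hm, h1⟩ <;>
    rcases hd z hz r hrI q₂ hq₂ hs₂ with ⟨hm', h2⟩ | ⟨hm', h2⟩
  · omega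
  · tauto
  · tauto
  · omega

theorem IsNonCrossing.shrinks_chord_left (hG : G.IsNonCrossing) (hc : G.Connected)
    {u v y m : V} {S : Set V} (huv : G.Adj u v) (hy : y ∈ Set.Icc u v) (hS : S ⊆ Set.Icc y v)
    (hm : G.dist y v = G.dist y m + G.dist m v) (h1 : G.dist y m < G.dist y u + G.dist u m)
    (h2 : G.dist m v < G.dist m u + G.dist u v) : G.Shrinks u v S := by
  obtain ⟨q₁, hq₁⟩ := hc.exists_walk_length_eq_dist y m
  obtain ⟨q₂, hq₂⟩ := hc.exists_walk_length_eq_dist m v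
  refine hG.shrinks_chord hc huv hy ⟨hy.1.trans hy.2, le_rfl⟩ hS (q₁.append q₂)
    (by rw [Walk.length_append, hq₁, hq₂, hm]) (.inl fun h => ?_)
  rw [Walk.mem_support_append_iff] at h
  rcases h with h | h
  · exact h1.ne (hc.dist_eq_add_of_mem_support hq₁ h)
  · exact h2.ne (hc.dist_eq_add_of_mem_support hq₂ h)

theorem IsNonCrossing.shrinks_chord_right (hG : G.IsNonCrossing) (hc : G.Connected)
    {u v z m : V} {S : Set V} (huv : G.Adj u v) (hz : z ∈ Set.Icc u v) (hS : S ⊆ Set.Icc u z)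
    (hm : G.dist z u = G.dist z m + G.dist m u) (h1 : G.dist z m < G.dist z v + G.dist v m)
    (h2 : G.dist m u < G.dist m v + G.dist v u) : G.Shrinks u v S := by
  obtain ⟨q₁, hq₁⟩ := hc.exists_walk_length_eq_dist z m
  obtain ⟨q₂, hq₂⟩ := hc.exists_walk_length_eq_dist m u
  refine hG.shrinks_chord hc huv ⟨le_rfl, hz.1.trans hz.2⟩ hz hS (q₁.append q₂).reverse
    (by rw [Walk.length_reverse, Walk.length_append, hq₁, hq₂, ← hm, dist_comm]) (.inr fun h => ?_)
  rw [Walk.support_reverse, List.mem_reverse, Walk.mem_support_append_iff] at h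
  rcases h with h | h
  · exact h1.ne (hc.dist_eq_add_of_mem_support hq₁ h)
  · exact h2.ne (hc.dist_eq_add_of_mem_support hq₂ h)

/-- A geodesic through both `u` and `v` has one of the two excluded lengths, according to which end
comes first. -/
theorem IsNonCrossing.shrinks_chord_of_dist_lt (hG : G.IsNonCrossing) (hc : G.Connected)
    {u v y z : V} {S : Set V} (huv : G.Adj u v) (hy : y ∈ Set.Icc u v) (hz : z ∈ Set.Icc u v)
    (hS : S ⊆ Set.Icc y z) (h1 : G.dist y z < G.dist y u + 1 + G.dist v z)
    (h2 : G.dist y z < G.dist y v + 1 + G.dist u z) : G.Shrinks u v S := by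
  obtain ⟨p, hp⟩ := hc.exists_walk_length_eq_dist y z
  refine hG.shrinks_chord hc huv hy hz hS p hp ?_
  by_contra! h
  have e1 := hc.dist_eq_add_of_mem_support hp h.1
  have e2 := hc.dist_eq_add_of_mem_support hp h.2
  have huv1 := dist_eq_one_iff_adj.2 huv
  classical
  have hv := h.2
  rw [← p.take_spec h.1, Walk.mem_support_append_iff] at hv
  rcases hv with h3 | h3
  · have := hc.dist_eq_add_of_mem_support
      (length_eq_dist_of_subwalk hp (p.isSubwalk_takeUntil h.1)) h3
    rw [dist_comm (u := v) (v := u)] at this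
    omega
  · have := hc.dist_eq_add_of_mem_support
      (length_eq_dist_of_subwalk hp (p.isSubwalk_dropUntil h.1)) h3
    omega

/-! ### Probing the ends of an interval -/

theorem exists_isLeast_isGreatest [Finite V] {S : Set V} (hS : S.Nonempty) :
    ∃ y ∈ S, ∃ z ∈ S, S ⊆ Set.Icc y z := by
  obtain ⟨y, hy, hymin⟩ := S.exists_min_image id S.toFinite hS
  obtain ⟨z, hz, hzmax⟩ := S.exists_max_image id S.toFinite hS
  exact ⟨y, hy, z, hz, fun x hx => ⟨hymin x hx, hzmax x hx⟩⟩

/-- The vertices of `[u, v]` with distances `a` and `b` to the probed vertices `c` and `e`. -/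
def intervalClass (G : SimpleGraph V) (u v c e : V) (a b : ℕ) : Set V :=
  {x | x ∈ Set.Icc u v ∧ G.dist x c = a ∧ G.dist x e = b}

theorem IsNonCrossing.subsingleton_or_shrinks_of_two_le_dist [Finite V] (hG : G.IsNonCrossing)
    (hc : G.Connected) {u v : V} (h : G.IsGeodesicInterval u v) (hD : 2 ≤ G.dist u v) (a b : ℕ) :
    (G.intervalClass u v u v a b).Subsingleton ∨
      G.Shrinks u v (G.closedNeighbors (G.intervalClass u v u v a b)) := by
  by_contra hcon
  obtain ⟨hns, hshr⟩ := not_or.1 hcon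
  -- A vertex on a geodesic from `u` to `v` would be identified by the probe, so the class avoids
  -- the barrier and its neighbors stay in `[u, v]`.
  have hgeo : ∀ x ∈ G.intervalClass u v u v a b, G.dist x u + G.dist x v ≠ G.dist u v := by
    intro x hx hxe
    have : ∀ s ∈ G.intervalClass u v u v a b, s = x := fun s hs =>
      hG.eq_of_dist_eq hc hx.1 hs.1 hxe (hs.2.1.trans hx.2.1.symm) (hs.2.2.trans hx.2.2.symm)
    exact hns fun s hs s' hs' => (this s hs).trans (this s' hs').symm
  have hN : ∀ y ∈ G.closedNeighbors (G.intervalClass u v u v a b), y ∈ Set.Icc u v := by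
    rintro y ⟨x, hx, hy⟩
    obtain ⟨p, hp, hps⟩ := h
    rcases hy with rfl | hy
    · exact hx.1
    · refine hG.mem_Icc_of_adj hx.1 (fun hxp => hgeo x hx ?_) hps hy
      rw [hc.dist_eq_add_of_mem_support hp hxp, dist_comm (u := u)]
  have hne : (G.intervalClass u v u v a b).Nonempty := by
    by_contra! hne
    exact hns (hne ▸ Set.subsingleton_empty)
  obtain ⟨y, hy, z, hz, hyz⟩ :=
    exists_isLeast_isGreatest (hne.mono (subset_closedNeighbors (G := G) _))
  have hyI := hN y hy
  have hzI := hN z hz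
  have h1 : G.dist y u + G.dist u v ≤ G.dist y v := by
    by_contra! h1
    exact hshr (hG.shrinks_left hc h hyI (hyz.trans (Set.Icc_subset_Icc le_rfl hzI.2)) h1)
  have h2 : G.dist z v + G.dist u v ≤ G.dist z u := by
    by_contra! h2
    exact hshr (hG.shrinks_right hc h hzI (hyz.trans (Set.Icc_subset_Icc hyI.1 le_rfl)) h2)
  obtain ⟨x, hx, hxy⟩ := hy
  obtain ⟨x', hx', hxz⟩ := hz
  have e1 := dist_le_one_of_eq_or_adj hxy
  have e2 := dist_le_one_of_eq_or_adj hxz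
  have t1 := hc.dist_triangle (u := y) (v := x) (w := v)
  have t2 := hc.dist_triangle (u := x) (v := y) (w := u)
  have t3 := hc.dist_triangle (u := z) (v := x') (w := u)
  have t4 := hc.dist_triangle (u := x') (v := z) (w := v)
  rw [dist_comm (u := y) (v := x)] at t1
  rw [dist_comm (u := z) (v := x')] at t3
  have hgx := hgeo x hx
  obtain ⟨hxI, hxu, hxv⟩ := hx
  obtain ⟨hxI', hxu', hxv'⟩ := hx'
  -- Here `b + 1 ≥ a - 1 + d(u, v)` and, by symmetry, `a + 1 ≥ b - 1 + d(u, v)`. So `d(u, v) = 2`,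
  -- `a = b`, `d(y, u) = a - 1` and `d(y, v) = a + 1`: stepping from `y` to `x` begins a geodesic to
  -- `v` that avoids `u`.
  have hyu : y ≠ u := by
    rintro rfl
    rw [dist_self] at *
    omega
  have hyx : G.Adj y x := by
    rcases hxy with rfl | hxy
    · omega
    · exact hxy.symm
  exact hshr (hG.shrinks_left_of_adj hc h hyI hxI (hyz.trans (Set.Icc_subset_Icc le_rfl hzI.2))
    hyx hyu (by omega) (by omega))

end SimpleGraph

namespace SimpleGraph

variable {V : Type*} {G : SimpleGraph V} [LinearOrder V]

theorem IsNonCrossing.mem_Icc_of_adj_chord (hG : G.IsNonCrossing) {u v s r : V} (huv : G.Adj u v)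
    (hs : s ∈ Set.Ioo u v) (h : G.Adj s r) : r ∈ Set.Icc u v := by
  by_contra hr
  rcases lt_or_ge r u with h1 | h1
  · exact hG _ _ _ _ h1 hs.1 hs.2 h.symm huv
  · exact hG _ _ _ _ hs.1 hs.2 (not_le.1 fun h2 => hr ⟨h1, h2⟩) huv h

/-- If probing the ends of the chord `uv` does not shrink the interval `[u, v]`, then there are a
triangle `u, w, v` inside of it and an edge `cx` across `[u, w]` with `c` closer to `u` and `x`
closer to `w`. -/
theorem IsNonCrossing.exists_triangle_of_not_shrinks [Finite V] (hG : G.IsNonCrossing)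
    (hc : G.Connected) {u v : V} (huv : G.Adj u v) (hlt : u < v) {a b : ℕ}
    (hns : ¬ (G.intervalClass u v u v a b).Subsingleton)
    (hshr : ¬ G.Shrinks u v (G.closedNeighbors (G.intervalClass u v u v a b))) :
    ∃ w c x t, u < c ∧ c < x ∧ x < w ∧ w < v ∧ G.Adj u w ∧ G.Adj w v ∧ G.Adj c x ∧ 1 ≤ t ∧
      G.dist c u = t ∧ G.dist c w = t + 1 ∧ G.dist c v = t + 1 ∧ G.dist x u = t + 1 ∧
      G.dist x w = t := by
  have comm : ∀ p q : V, G.dist p q = G.dist q p := fun _ _ => dist_comm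
  have tri : ∀ p q r : V, G.dist p r ≤ G.dist p q + G.dist q r := fun _ _ _ => hc.dist_triangle
  have hd := dist_eq_one_iff_adj.2 huv
  have hd' := dist_eq_one_iff_adj.2 huv.symm
  have ha : 1 ≤ a := by
    by_contra! ha
    refine hns fun s hs s' hs' => ?_
    have h1 := hc.dist_eq_zero_iff.1 (hs.2.1.trans (by omega))
    have h2 := hc.dist_eq_zero_iff.1 (hs'.2.1.trans (by omega))
    rw [h1, h2]
  have hb : 1 ≤ b := by
    by_contra! hb
    refine hns fun s hs s' hs' => ?_
    have h1 := hc.dist_eq_zero_iff.1 (hs.2.2.trans (by omega))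
    have h2 := hc.dist_eq_zero_iff.1 (hs'.2.2.trans (by omega))
    rw [h1, h2]
  have hIoo : ∀ s ∈ G.intervalClass u v u v a b, s ∈ Set.Ioo u v := by
    rintro s ⟨hs, hsu, hsv⟩
    refine ⟨hs.1.lt_of_ne ?_, hs.2.lt_of_ne ?_⟩ <;> rintro rfl <;> rw [dist_self] at * <;> omega
  have hN : ∀ y ∈ G.closedNeighbors (G.intervalClass u v u v a b), y ∈ Set.Icc u v := by
    rintro y ⟨x, hx, rfl | hy⟩
    exacts [hx.1, hG.mem_Icc_of_adj_chord huv (hIoo x hx) hy]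
  have hne : (G.intervalClass u v u v a b).Nonempty := by
    by_contra! hne
    exact hns (hne ▸ Set.subsingleton_empty)
  obtain ⟨y, hy, z, hz, hyz⟩ :=
    exists_isLeast_isGreatest (hne.mono (subset_closedNeighbors (G := G) _))
  have hyI := hN y hy
  have hzI := hN z hz
  obtain ⟨x, hx, hxy⟩ := hy
  obtain ⟨x', hx', hxz⟩ := hz
  have hyx := (hyz (subset_closedNeighbors _ hx)).1
  have hyx' := (hyz (subset_closedNeighbors _ hx')).1
  have hxz' := (hyz (subset_closedNeighbors _ hx)).2
  have B1 : ∀ m, G.dist y v = G.dist y m + G.dist m v →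
      G.dist y u + G.dist u m ≤ G.dist y m ∨ G.dist m u + G.dist u v ≤ G.dist m v := by
    intro m hm
    by_contra! h
    exact hshr (hG.shrinks_chord_left hc huv hyI
      (hyz.trans (Set.Icc_subset_Icc le_rfl hzI.2)) hm h.1 h.2)
  have B2 : ∀ m, G.dist z u = G.dist z m + G.dist m u →
      G.dist z v + G.dist v m ≤ G.dist z m ∨ G.dist m v + G.dist v u ≤ G.dist m u := by
    intro m hm
    by_contra! h
    exact hshr (hG.shrinks_chord_right hc huv hzI
      (hyz.trans (Set.Icc_subset_Icc hyI.1 le_rfl)) hm h.1 h.2)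
  have B3 : G.dist y u + 1 + G.dist v z ≤ G.dist y z ∨ G.dist y v + 1 + G.dist u z ≤ G.dist y z := by
    by_contra! h
    exact hshr (hG.shrinks_chord_of_dist_lt hc huv hyI hzI hyz h.1 h.2)
  have e1 := dist_le_one_of_eq_or_adj hxy
  have e2 := dist_le_one_of_eq_or_adj hxz
  obtain ⟨hxI, hxu, hxv⟩ := id hx
  obtain ⟨hxI', hxu', hxv'⟩ := id hx'
  have hyv : G.dist y u + 1 ≤ G.dist y v := by
    rcases B1 y (by simp) with h | h
    · rw [dist_self] at h
      have : y = u := hc.dist_eq_zero_iff.1 (by omega)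
      rw [this, hd, dist_self]
    · omega
  have hzu : G.dist z v + 1 ≤ G.dist z u := by
    rcases B2 z (by simp) with h | h
    · rw [dist_self] at h
      have : z = v := hc.dist_eq_zero_iff.1 (by omega)
      rw [this, hd', dist_self]
    · omega
  have c1 := comm y x
  have c2 := comm z x'
  have c3 := comm v z
  have c4 := comm u z
  have t1 := tri y u v
  have t2 := tri z v u
  have t3 := tri x y u
  have t4 := tri y x v
  have t5 := tri x' z v
  have t6 := tri z x' u
  have t7 := tri y u z
  have t8 := tri x u v
  have t9 := tri x v u
  have t10 := tri y x u
  have t11 := tri z x' v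
  have t12 := tri u v z
  have c5 := comm v x'
  have c6 := comm u x
  have hab : a = b := by
    by_contra hab
    have h := B1 x
    have h' := B2 x'
    omega
  subst hab
  have hyu : G.dist y u + 1 = a := by
    have h := B1 x
    omega
  have hzv : G.dist z v + 1 = a := by
    have h := B2 x'
    omega
  have hayx : G.Adj y x := by
    rcases hxy with rfl | h
    · omega
    · exact h.symm
  have hazx : G.Adj z x' := by
    rcases hxz with rfl | h
    · omega
    · exact h.symm
  have hyx1 := hyx.lt_of_ne hayx.ne
  have hx'z := ((hyz (subset_closedNeighbors _ hx')).2).lt_of_ne hazx.ne.symm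
  have hux := (hIoo x hx).1
  have hux' := (hIoo x' hx').1
  have hxv1 := (hIoo x hx).2
  have hxv1' := (hIoo x' hx').2
  -- For `a = 1` the class consists of common neighbors of `u` and `v`, and two of these would give
  -- crossing edges.
  have ha2 : 2 ≤ a := by
    by_contra! ha2
    have key : ∀ s s' : V, s ∈ G.intervalClass u v u v a a → s' ∈ G.intervalClass u v u v a a →
        ¬ s < s' := by
      intro s s' hs hs' h
      refine hG _ _ _ _ (hIoo s hs).1 h (hIoo s' hs').2 ?_ ?_
      · exact (dist_eq_one_iff_adj.1 (hs'.2.1.trans (by omega))).symm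
      · exact dist_eq_one_iff_adj.1 (hs.2.2.trans (by omega))
    exact hns fun s hs s' hs' => le_antisymm (not_lt.1 (key s' s hs' hs)) (not_lt.1 (key s s' hs hs'))
  have hyz' : 2 * a - 1 ≤ G.dist y z := by omega
  -- Otherwise the edges `yx` and `x'z` cross, or `y` and `z` are too close for `hyz'`.
  have hxx' : x < x' := by
    rcases lt_trichotomy x x' with h | h | h
    · exact h
    · subst h
      have := tri y x z
      omega
    · refine absurd hazx.symm (hG _ _ _ _ (hyx'.lt_of_ne ?_) h (hxz'.lt_of_ne ?_) hayx)
      · rintro rfl; omega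
      · rintro rfl; omega
  -- The triangle inequalities force `d(w, u) = d(w, v) = e` and `d(x, w) = d(x', w) = a - e`. The
  -- route `y, x, w, x', z` has length at most `2(a - e) + 2`, so `hyz'` gives `e ≤ 1`.
  obtain ⟨w, hw1, hw2⟩ := hG.exists_dist_eq_add hc hux hxx' hxv1'
  have s1 := tri x w u
  have s2 := tri x' w v
  have s3 := tri y x z
  have s4 := tri x w z
  have s5 := tri w x' z
  have k1 := comm u x'
  have k2 := comm u w
  have k3 := comm x' w
  have k4 := comm v w
  have hwu0 : G.dist w u ≠ 0 := fun h => by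
    have := hc.dist_eq_zero_iff.1 h
    subst this
    omega
  have hwu : G.dist w u = 1 := by omega
  have hwv : G.dist w v = 1 := by omega
  have hxw : G.dist x w + 1 = a := by omega
  have hwI : w ∈ Set.Ioo u v := by
    by_contra hw
    have := hG.dist_chord hc huv hxI hw
    omega
  have auw := (dist_eq_one_iff_adj.1 hwu).symm
  have awv := dist_eq_one_iff_adj.1 hwv
  have s6 := tri y x w
  have s7 := tri y w v
  have hyw : G.dist y w = a := by
    have h := B1 w
    omega
  have hyltw : y < w := by
    by_contra! h
    have := hG.dist_chord hc awv ⟨h, hyI.2⟩ (d := u) fun h' => lt_asymm h'.1 hwI.1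
    omega
  have huy : u < y := hyI.1.lt_of_ne (by rintro rfl; rw [dist_self] at *; omega)
  have hxltw : x < w := by
    rcases lt_trichotomy x w with h | h | h
    · exact h
    · subst h
      rw [dist_self] at hxw
      omega
    · exact absurd hayx (hG _ _ _ _ huy hyltw h auw)
  exact ⟨w, y, x, a - 1, huy, hyx1, hxltw, hwI.2, auw, awv, hayx, by omega, by omega, by omega,
    by omega, by omega, by omega⟩

end SimpleGraph

/-! ### The second probe for a chord -/

namespace SimpleGraph

variable {V : Type*} {G : SimpleGraph V} [LinearOrder V]

/-- If `y` is under the chord `cx`, its geodesic to `u` passes `c` or `x`, and both contradict the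
distances. If `y` is beyond `x`, geodesics `u`–`y` and `x`–`w` meet, and exchanging their halves
gains 2. -/
theorem IsNonCrossing.false_of_two_edges_across (hG : G.IsNonCrossing) (hc : G.Connected)
    {u w c x y z : V} {t f : ℕ} (huc : u < c) (hcx : c < x) (hzw : z < w) (hcy : c < y)
    (hyz : y < z) (acx : G.Adj c x) (ht : 1 ≤ t) (hcu : G.dist c u = t) (hxu : G.dist x u = t + 1)
    (hxw : G.dist x w = t) (hyu : G.dist y u = f) (hyw : G.dist y w = f + 1)
    (hyc : G.dist y c = f + t) : False := by
  have tri : ∀ p q r : V, G.dist p r ≤ G.dist p q + G.dist q r := fun _ _ _ => hc.dist_triangle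
  rcases lt_trichotomy y x with h | rfl | h
  · have h1 := hG.dist_chord hc acx ⟨hcy.le, h.le⟩ (d := u) fun h' => lt_asymm h'.1 huc
    have h2 := tri y x w
    omega
  · omega
  · obtain ⟨g, h1, h2⟩ := hG.exists_dist_eq_add hc (huc.trans hcx) h (hyz.trans hzw)
    have h3 := tri y g w
    have h4 := tri x g u
    rw [dist_comm (u := u) (v := y), dist_comm (u := u) (v := g), dist_comm (u := g) (v := y)] at h1
    omega

theorem IsNonCrossing.subsingleton_or_shrinks_of_triangle [Finite V] (hG : G.IsNonCrossing)
    (hc : G.Connected) {u v w c x : V} {t : ℕ} (huv : G.Adj u v) (huc : u < c) (hcx : c < x)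
    (hxw : x < w) (hwv : w < v) (auw : G.Adj u w) (awv : G.Adj w v) (acx : G.Adj c x) (ht : 1 ≤ t)
    (hcu : G.dist c u = t) (hcw : G.dist c w = t + 1) (hcv : G.dist c v = t + 1)
    (hxu : G.dist x u = t + 1) (hxw' : G.dist x w = t) (a b : ℕ) :
    (G.intervalClass u v c v a b).Subsingleton ∨
      G.Shrinks u v (G.closedNeighbors (G.intervalClass u v c v a b)) := by
  have comm : ∀ p q : V, G.dist p q = G.dist q p := fun _ _ => dist_comm
  have tri : ∀ p q r : V, G.dist p r ≤ G.dist p q + G.dist q r := fun _ _ _ => hc.dist_triangle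
  have zero : ∀ p q : V, G.dist p q = 0 → p = q := fun _ _ => hc.dist_eq_zero_iff.1
  have huw : u < w := huc.trans (hcx.trans hxw)
  have hcI : c ∈ Set.Icc u w := ⟨huc.le, (hcx.trans hxw).le⟩
  have duv := dist_eq_one_iff_adj.2 huv
  have duw := dist_eq_one_iff_adj.2 auw
  have dwv := dist_eq_one_iff_adj.2 awv
  by_contra hcon
  obtain ⟨hns, hshr⟩ := not_or.1 hcon
  set S := G.intervalClass u v c v a b with hSdef
  have huniq : ∀ r, ¬ ∀ s ∈ S, s = r := fun r hr =>
    hns fun s hs s' hs' => (hr s hs).trans (hr s' hs').symm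
  -- Vertices of `[w, v]`.
  have hright : ∀ s, w ≤ s → s ≤ v →
      (G.dist s c = t + G.dist s u ∨ G.dist s c = t + 1 + G.dist s w) ∧
      (G.dist s u = G.dist s w + 1 ∨ G.dist s u = G.dist s v + 1) := by
    intro s h1 h2
    have e1 := hG.dist_chord hc auw hcI (d := s) fun h' => not_lt.2 h1 h'.2
    have e2 := hG.dist_chord hc awv ⟨h1, h2⟩ (d := u) fun h' => lt_asymm h'.1 huw
    have c1 := comm s c
    have c2 := comm s u
    have c3 := comm s w
    have c4 := comm w u
    have c5 := comm v u
    omega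
  -- Vertices of `(u, w)`.
  have hleft : ∀ s, u ≤ s → s < w → G.dist s v = G.dist s u + 1 ∨ G.dist s v = G.dist s w + 1 := by
    intro s h1 h2
    have e1 := hG.dist_chord hc auw ⟨h1, h2.le⟩ (d := v) fun h' => lt_asymm h'.2 hwv
    omega
  have hu : u ∉ S := by
    rintro ⟨-, h1, h2⟩
    refine huniq u fun s ⟨hs, hs1, hs2⟩ => zero _ _ ?_
    have c1 := comm u c
    rcases lt_or_ge s w with h | h
    · have e := hleft s hs.1 h
      have : G.dist s w ≠ 0 := fun h0 => h.ne (zero _ _ h0)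
      omega
    · have e := hright s h hs.2
      omega
  have hv : v ∉ S := by
    rintro ⟨-, h1, h2⟩
    refine huniq v fun s ⟨hs, hs1, hs2⟩ => zero _ _ ?_
    rw [hs2, ← h2, dist_self]
  have hSI : ∀ s ∈ S, s ∈ Set.Ioo u v := fun s hs =>
    ⟨hs.1.1.lt_of_ne fun h => hu (h ▸ hs), hs.1.2.lt_of_ne fun h => hv (h ▸ hs)⟩
  have hN : ∀ y ∈ G.closedNeighbors S, y ∈ Set.Icc u v := by
    rintro y ⟨s, hs, rfl | hy⟩
    exacts [hs.1, hG.mem_Icc_of_adj_chord huv (hSI s hs) hy]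
  -- Every vertex `s` of `[w, v]` has `d(s, c) ≥ d(s, v) + t`. So below this threshold the class
  -- lies under the chord `uw`, which then bounds the new interval.
  rcases lt_or_ge a (b + t) with hab | hab
  · refine hshr ⟨u, w, auw.isGeodesicInterval huw, ?_, Set.Icc_subset_Icc le_rfl hwv.le,
      fun h => not_lt.2 (h ⟨(huw.trans hwv).le, le_rfl⟩).2 hwv⟩
    have hlt : ∀ s ∈ S, s ∈ Set.Ioo u w := by
      intro s hs
      refine ⟨(hSI s hs).1, ?_⟩
      by_contra! h
      have e := hright s h hs.1.2
      obtain ⟨-, h1, h2⟩ := hs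
      have t1 := tri s w v
      omega
    rintro y ⟨s, hs, rfl | hy⟩
    exacts [⟨(hlt _ hs).1.le, (hlt _ hs).2.le⟩, hG.mem_Icc_of_adj_chord auw (hlt s hs) hy]
  -- Above the threshold, a class member left of `w` must reach `v` through `w`, and all the bounds
  -- become equalities.
  have hS : ∀ s ∈ S, s < w → G.dist s w + 1 = b ∧ G.dist s u = b ∧ G.dist s c = b + t := by
    intro s hs h
    have e := hleft s hs.1.1 h
    obtain ⟨-, h1, h2⟩ := hs
    have t1 := tri s u c
    have t2 := tri s u v
    have t3 := tri s w u
    have t4 := tri s w c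
    have c1 := comm u c
    have c2 := comm w u
    have c3 := comm w c
    omega
  have hw : w ∉ S := by
    rintro ⟨-, h1, h2⟩
    refine huniq w fun s hs => ?_
    have c1 := comm w c
    rcases lt_or_ge s w with h | h
    · have := hS s hs h
      exact zero _ _ (by omega)
    · have e := hright s h hs.1.2
      obtain ⟨-, h3, h4⟩ := hs
      exact zero _ _ (by omega)
  have hNr : ∀ s ∈ S, w ≤ s → ∀ y, y = s ∨ G.Adj s y → y ∈ Set.Icc w v := by
    rintro s hs h y (rfl | hy)
    · exact ⟨h, hs.1.2⟩
    · exact hG.mem_Icc_of_adj_chord awv ⟨h.lt_of_ne fun h' => hw (h' ▸ hs), (hSI s hs).2⟩ hy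
  by_cases hall : ∀ s ∈ S, w ≤ s
  · exact hshr ⟨w, v, awv.isGeodesicInterval hwv,
      fun y ⟨s, hs, hy⟩ => hNr s hs (hall s hs) y hy, Set.Icc_subset_Icc huw.le le_rfl,
      fun h => not_lt.2 (h ⟨le_rfl, (huw.trans hwv).le⟩).1 huw⟩
  push Not at hall
  obtain ⟨s₀, hs₀, hs₀w⟩ := hall
  obtain ⟨y, hy, z, hz, hyz⟩ :=
    exists_isLeast_isGreatest (S := G.closedNeighbors S) ⟨s₀, subset_closedNeighbors _ hs₀⟩
  have hyI := hN y hy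
  have hzI := hN z hz
  have hyw : y < w := (hyz (subset_closedNeighbors _ hs₀)).1.trans_lt hs₀w
  obtain ⟨x', hx', hxy⟩ := hy
  have hx'w : x' < w := by
    by_contra! h
    exact not_lt.2 (hNr x' hx' h y hxy).1 hyw
  obtain ⟨h1, h2, h3⟩ := hS x' hx' hx'w
  have hx'v : G.dist x' v = b := hx'.2.2
  have hx'w0 : G.dist x' w ≠ 0 := fun h => hx'w.ne (zero _ _ h)
  have B1 : ∀ m, G.dist y v = G.dist y m + G.dist m v →
      G.dist y u + G.dist u m ≤ G.dist y m ∨ G.dist m u + G.dist u v ≤ G.dist m v := by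
    intro m hm
    by_contra! h
    exact hshr (hG.shrinks_chord_left hc huv hyI
      (hyz.trans (Set.Icc_subset_Icc le_rfl hzI.2)) hm h.1 h.2)
  have e1 := dist_le_one_of_eq_or_adj hxy
  have b1 := B1 x'
  have b2 := B1 w
  have c1 := comm y x'
  have c2 := comm u x'
  have c3 := comm w u
  have c4 := comm u c
  have t1 := tri y x' v
  have t2 := tri x' y u
  have t3 := tri x' y c
  have t4 := tri y u c
  have t5 := tri y x' w
  have t6 := tri y w v
  have t7 := tri y u v
  have hyv : G.dist y u + 1 ≤ G.dist y v := by
    rcases B1 y (by simp) with h | h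
    · rw [dist_self] at h
      have : y = u := zero _ _ (by omega)
      rw [this, duv, dist_self]
    · omega
  have hayx : G.Adj y x' := by
    rcases hxy with rfl | h
    · omega
    · exact h.symm
  have hyx' := (hyz (subset_closedNeighbors _ hx')).1.lt_of_ne hayx.ne
  have hyu : G.dist y u + 1 = b := by omega
  have hyu' : u < y := hyI.1.lt_of_ne (by rintro rfl; rw [dist_self] at *; omega)
  have hyw' : G.dist y w = G.dist y u + 1 := by omega
  have hyc : G.dist y c = G.dist y u + t := by omega
  -- The edge `yx'` now goes across `[u, w]` just as `cx` does. The previous lemma applies with the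
  -- two edges in either order.
  rcases lt_trichotomy c y with h | rfl | h
  · exact hG.false_of_two_edges_across hc huc hcx hx'w h hyx' acx ht hcu hxu hxw' rfl hyw' hyc
  · rw [dist_self] at hyc
    omega
  · exact hG.false_of_two_edges_across hc hyu' hyx' hxw h hcx hayx (by omega) rfl
      (by omega) (by omega) hcu hcw (by rw [comm c y, hyc, add_comm])

theorem IsNonCrossing.exists_probe [Finite V] (hG : G.IsNonCrossing) (hc : G.Connected) {u v : V}
    (h : G.IsGeodesicInterval u v) (huv : u < v) : ∃ c e, ∀ a b,
      (G.intervalClass u v c e a b).Subsingleton ∨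
      G.Shrinks u v (G.closedNeighbors (G.intervalClass u v c e a b)) := by
  have hpos := hc.pos_dist_of_ne huv.ne
  rcases Nat.lt_or_ge (G.dist u v) 2 with hd | hd
  · have auv := dist_eq_one_iff_adj.1 (show G.dist u v = 1 by omega)
    -- The probe `c` is extracted from a class on which the pair `(u, v)` fails.
    by_contra! hcon
    obtain ⟨a, b, h1, h2⟩ := hcon u v
    obtain ⟨w, c, x, t, huc, hcx, hxw, hwv, auw, awv, acx, ht, hcu, hcw, hcv, hxu, hxw'⟩ :=
      hG.exists_triangle_of_not_shrinks hc auv huv (Set.not_subsingleton_iff.2 h1) h2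
    obtain ⟨a', b', h3, h4⟩ := hcon c v
    exact (hG.subsingleton_or_shrinks_of_triangle hc auv huc hcx hxw hwv auw awv acx ht hcu hcw
      hcv hxu hxw' a' b').elim (Set.not_subsingleton_iff.2 h3) h4
  · exact ⟨u, v, hG.subsingleton_or_shrinks_of_two_le_dist hc h hd⟩

/-- Every unsuccessful round removes at least one vertex from the interval, and a single vertex
needs no probe. -/
theorem IsNonCrossing.winFrom_Icc [Finite V] (hG : G.IsNonCrossing) (hc : G.Connected) (T : ℕ)
    {u v : V} (h : G.IsGeodesicInterval u v) (hT : (Set.Icc u v).ncard ≤ T + 1) :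
    G.WinFrom 2 T (Set.Icc u v) := by
  have := hc.nonempty
  induction T generalizing u v with
  | zero => exact (Set.ncard_le_one_iff_subsingleton).1 hT
  | succ T ih =>
    rcases lt_or_ge u v with huv | huv
    · obtain ⟨c, e, hce⟩ := hG.exists_probe hc h huv
      refine ⟨![c, e], fun p => ?_⟩
      have hsub : G.probeClass ![c, e] p (Set.Icc u v) ⊆
          G.intervalClass u v c e (p 0) (p 1) := by
        rintro x ⟨hx, rfl⟩
        exact ⟨hx, dist_comm, dist_comm⟩
      refine (hce (p 0) (p 1)).imp (fun h => h.anti hsub) ?_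
      rintro ⟨u', v', h', hS, hlt⟩
      refine (ih h' ?_).mono_set ((closedNeighbors_mono hsub).trans hS)
      have := Set.ncard_lt_ncard hlt
      omega
    · exact WinFrom.mono_time (Nat.zero_le _) (Set.subsingleton_Icc_of_ge huv)

theorem IsNonCrossing.copsWinWithin [Finite V] (hG : G.IsNonCrossing) (hc : G.Connected) :
    G.CopsWinWithin 2 (Nat.card V - 1) := by
  have hne := hc.nonempty
  obtain ⟨u, -, v, -, huv⟩ := exists_isLeast_isGreatest (S := (Set.univ : Set V)) Set.univ_nonempty
  obtain ⟨p, hp⟩ := hc.exists_walk_length_eq_dist u v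
  have hw := hG.winFrom_Icc hc (Nat.card V - 1) ⟨p, hp, fun x _ => huv trivial⟩
    ((Set.ncard_le_card _).trans (by omega))
  exact (hw.mono_set huv).copsWinWithin

end SimpleGraph

theorem proposition3p1 :
    (∀ (V : Type u) [Finite V] (G : SimpleGraph V), G.Connected → G.IsOuterplanar →
      ∀ (m : ℕ) (B : Fin m → G.Subgraph),
        (∀ i, SimpleGraph.IsBlock (B i)) →
        (∀ i j, i ≠ j → Disjoint (B i).edgeSet (B j).edgeSet) →
        (⨆ i, B i) = ⊤ →
        G.kLocalizationCaptureTime 2 ≤ ((∑ i, ((B i).verts.ncard - 1) : ℕ) : ℕ∞)) ∧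
    (∀ (V : Type u) [Finite V] (G : SimpleGraph V), G.Connected → G.IsOuterplanar →
      G.localizationNumber = 2 →
        G.localizationCaptureTime ≤ ((Nat.card V - 1 : ℕ) : ℕ∞)) ∧
    SimpleGraph.WellLocalizable.{u} (fun _ G =>
      G.Connected ∧ G.IsOuterplanar ∧ G.localizationNumber = 2) := by
  have key : ∀ (V : Type u) [Finite V] (G : SimpleGraph V), G.Connected → G.IsOuterplanar →
      G.kLocalizationCaptureTime 2 ≤ ((Nat.card V - 1 : ℕ) : ℕ∞) := by
    intro V _ G hc hG
    obtain ⟨_, hG⟩ := hG.exists_linearOrder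
    exact (hG.copsWinWithin hc).captureTime_le
  have key2 : ∀ (V : Type u) [Finite V] (G : SimpleGraph V), G.Connected → G.IsOuterplanar →
      G.localizationNumber = 2 →
        G.localizationCaptureTime ≤ ((Nat.card V - 1 : ℕ) : ℕ∞) := by
    intro V _ G hc hG h2
    rw [SimpleGraph.localizationCaptureTime, h2]
    exact key V G hc hG
  refine ⟨fun V _ G hc hG m B hB _ hcover => (key V G hc hG).trans ?_, key2, 1, ?_⟩
  · exact_mod_cast hc.card_sub_one_le_sum B (fun i => (hB i).prop.1) hcover
  · rintro V _ G ⟨hc, hG, h2⟩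
    refine (key2 V G hc hG h2).trans ?_
    rw [Nat.cast_one, one_mul]
    exact_mod_cast Nat.sub_le _ _
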